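/- Let $X$ and $Y$ be path-connected spaces, each having the homotopy type of a CW-complex, let $p\colon \tilde X\to X$ and $q\colon \tilde Y\to Y$ be universal coverings (covering maps with simply connected total spaces), let $f\colon X\to Y$ be a continuous map, and let $\tilde f_0\colon\tilde X\to\tilde Y$ be a lifting of $f$, i.e. $q\tilde f_0=fp$. Fix $x_0\in X$ and $\tilde x_0\in p^{-1}(x_0)$. Let $\mathcal D(X)$ and $\mathcal D(Y)$ be the groups of deck transformations of $p$ and $q$. For each $l\in\mathcal D(X)$ there is a unique $f_*(l)\in\mathcal D(Y)$ with $\tilde f_0\, l=f_*(l)\,\tilde f_0$. The map which sends $h\in\mathcal D(Y)$ to the class of $q\circ\gamma$ in $\pi_1(Y,f(x_0))$, for any path $\gamma$ in $\tilde Y$ from $\tilde f_0(\tilde x_0)$ to $h\tilde f_0(\tilde x_0)$, is bijective; it is the inverse of the canonical isomorphism $\pi_1(Y,f(x_0))\cong\mathcal D(Y)$. We use it to identify the two groups. Define: - $G^f(Y,f(x_0))\subseteq\pi_1(Y,f(x_0))$, the generalized Gottlieb group: all elements that can be represented by a map $\alpha\colon\mathbb S^1\to Y$ such that $f\vee\alpha\colon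 X\vee\mathbb S^1\to Y$ extends, up to homotopy, to a map $F\colon X\times\mathbb S^1\to Y$; - $\mathcal H^{\tilde f_0}(Y)\subseteq\mathcal D(Y)$: all elements $h$ of the centralizer of $f_*(\mathcal D(X))$ in $\mathcal D(Y)$ such that $\tilde f_0$ and $h\tilde f_0$ are homotopic; - $P^f(Y,f(x_0))\subseteq\pi_1(Y,f(x_0))$, the generalized Whitehead center group: all elements $\alpha$ whose Whitehead products $[f\beta,\alpha]$ vanish for all $\beta\in\pi_m(X,x_0)$ and all $m\ge1$. Then, under the identification $\pi_1(Y,f(x_0))\cong\mathcal D(Y)$, $$G^f(Y,f(x_0))\subseteq\mathcal H^{\tilde f_0}(Y)\subseteq P^f(Y,f(x_0)).$$ -/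

import Mathlib

open scoped unitInterval Topology ContinuousMap

noncomputable section

namespace GottliebDeck

universe u v w z

/-- `X` has the homotopy type of a CW complex. -/
def HasCWHomotopyType (X : Type u) [TopologicalSpace X] : Prop :=
  ∃ (K : Type u) (_ : TopologicalSpace K), T2Space K ∧
    Nonempty (Topology.CWComplex (Set.univ : Set K)) ∧ Nonempty (X ≃ₕ K)

/-! ### Deck transformations -/

section Deck

/-- The group of deck transformations of `q : E → B`: the homeomorphisms `h` of `E` with
`q ∘ h = q`, under composition. -/
def Deck {E : Type u} {B : Type v} [TopologicalSpace E] [TopologicalSpace B] (q : C(E, B)) :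
    Subgroup (E ≃ₜ E) where
  carrier := {h | ∀ e, q (h e) = q e}
  mul_mem' := by
    intro a b ha hb e
    exact (ha (b e)).trans (hb e)
  one_mem' := fun _ => rfl
  inv_mem' := by
    intro a ha e
    have h := ha (a.symm e)
    rw [a.apply_symm_apply] at h
    exact h.symm

variable {E : Type u} {B : Type v} [TopologicalSpace E] [TopologicalSpace B]

/-- For a simply connected `E` with base-point `e₀` over `b₀`, the loop class in `π₁(B, b₀)` that
corresponds to the deck transformation `h`: the class of `q ∘ γ`, where `γ` is any path in `E`
from `e₀` to `h e₀` (see `deckLoopClass_eq` for the independence of `γ`). For universal coverings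
this is the inverse of the canonical isomorphism from `π₁(B, b₀)` to the deck group, which sends
the class of a loop `α` to the unique `h` such that the lift of `α` starting at `e₀` ends at
`h e₀`. -/
def deckLoopClass [SimplyConnectedSpace E] (q : C(E, B)) (e₀ : E) (b₀ : B) (hb : q e₀ = b₀)
    (h : Deck q) : FundamentalGroup B b₀ :=
  FundamentalGroup.fromPath (Path.Homotopic.Quotient.mk
    (((PathConnectedSpace.somePath e₀ (h.1 e₀)).map q.continuous).cast hb.symm
      ((h.2 e₀).trans hb).symm))

theorem deckLoopClass_eq [SimplyConnectedSpace E] (q : C(E, B)) (e₀ : E) (b₀ : B)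
    (hb : q e₀ = b₀) (h : Deck q) (γ : Path e₀ (h.1 e₀)) :
    deckLoopClass q e₀ b₀ hb h = FundamentalGroup.fromPath (Path.Homotopic.Quotient.mk
      ((γ.map q.continuous).cast hb.symm ((h.2 e₀).trans hb).symm)) := by
  subst hb
  have key := (SimplyConnectedSpace.paths_homotopic
    (PathConnectedSpace.somePath e₀ (h.1 e₀)) γ).map q
  obtain ⟨K⟩ := key
  exact Quotient.sound ⟨K.cast rfl rfl⟩

/-- The correspondence is multiplicative: the product `h * k` (composition) goes to the
concatenation of the loop of `h` followed by the loop of `k`. (In Mathlib's fundamental group,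
`a * b` is `b` followed by `a`.) -/
theorem deckLoopClass_mul [SimplyConnectedSpace E] (q : C(E, B)) (e₀ : E) (b₀ : B)
    (hb : q e₀ = b₀) (h k : Deck q) :
    deckLoopClass q e₀ b₀ hb (h * k) =
      deckLoopClass q e₀ b₀ hb k * deckLoopClass q e₀ b₀ hb h := by
  let γ := PathConnectedSpace.somePath e₀ (h.1 e₀)
  let δ := PathConnectedSpace.somePath e₀ (k.1 e₀)
  rw [deckLoopClass_eq q e₀ b₀ hb (h * k) (γ.trans (δ.map h.1.continuous)),
    deckLoopClass_eq q e₀ b₀ hb h γ, deckLoopClass_eq q e₀ b₀ hb k δ]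
  subst hb
  rw [FundamentalGroup.mul_def]
  refine congrArg (fun p => FundamentalGroup.fromPath (Path.Homotopic.Quotient.mk p)) ?_
  ext t
  have h1 : q ((γ.trans (δ.map h.1.continuous)) t) =
      ((γ.map q.continuous).trans ((δ.map h.1.continuous).map q.continuous)) t := by
    rw [← Path.map_trans]
    rfl
  refine h1.trans ?_
  simp only [Path.cast_coe, Path.map_coe, Function.comp_apply, Path.trans_apply]
  split_ifs
  · rfl
  · exact h.2 _

end Deck

section Lift

variable {X : Type u} {Y : Type v} {X' : Type w} {Y' : Type z}
  [TopologicalSpace X] [TopologicalSpace Y] [TopologicalSpace X'] [TopologicalSpace Y']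

/-- `f'` is a lifting of `f` with respect to `p` and `q`. -/
def IsLifting (p : C(X', X)) (q : C(Y', Y)) (f : C(X, Y)) (f' : C(X', Y')) : Prop :=
  ∀ x, q (f' x) = f (p x)

/-- `k = f_*(l)`, that is, `f̃₀ ∘ l = k ∘ f̃₀`. -/
def IsInduced {p : C(X', X)} {q : C(Y', Y)} (f₀ : C(X', Y')) (l : Deck p) (k : Deck q) : Prop :=
  ∀ x, f₀ (l.1 x) = k.1 (f₀ x)

/-- The image `f_*(𝒟(X))` in `𝒟(Y)`. -/
def inducedImage (p : C(X', X)) (q : C(Y', Y)) (f₀ : C(X', Y')) : Set (Deck q) :=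
  {k | ∃ l : Deck p, IsInduced f₀ l k}

/-- `ℋ^{f̃₀}(Y)`: the elements `h` of the centralizer of `f_*(𝒟(X))` in `𝒟(Y)` for which `f̃₀` and
`h ∘ f̃₀` are (freely) homotopic. -/
def homotopyDeck (p : C(X', X)) (q : C(Y', Y)) (f₀ : C(X', Y')) : Set (Deck q) :=
  {h | h ∈ Subgroup.centralizer (inducedImage p q f₀) ∧
    f₀.Homotopic ((h.1 : C(Y', Y')).comp f₀)}

end Lift

/-! ### The generalized Gottlieb group -/

section Gottlieb

/-- The path in `Y` underlying a map of the circle `ℝ / ℤ` to `Y`. -/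
def circleLoop {Y : Type v} [TopologicalSpace Y] (α : C(UnitAddCircle, Y)) : Path (α 0) (α 0) where
  toFun t := α ((t : ℝ) : UnitAddCircle)
  continuous_toFun := α.continuous.comp
    ((AddCircle.continuous_mk' (1 : ℝ)).comp continuous_subtype_val)
  source' := by simp
  target' := by
    have h : (((1 : unitInterval) : ℝ) : UnitAddCircle) = 0 := AddCircle.coe_period 1
    exact congrArg α h

variable {X : Type u} {Y : Type v} [TopologicalSpace X] [TopologicalSpace Y]

/-- `F : X × S¹ → Y` extends `f ∨ α : X ∨ S¹ → Y` up to homotopy. A homotopy on `X ∨ S¹` is a pair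
of homotopies on `X` and on `S¹` that agree at the base-point at all times. -/
def ExtendsWedge (f : C(X, Y)) (x₀ : X) (α : C(UnitAddCircle, Y)) (F : C(X × UnitAddCircle, Y)) :
    Prop :=
  ∃ (K : (F.comp (.prodMk (.id X) (.const X 0))).Homotopy f)
    (L : (F.comp (.prodMk (.const UnitAddCircle x₀) (.id UnitAddCircle))).Homotopy α),
    ∀ t, K (t, x₀) = L (t, 0)

/-- The generalized Gottlieb group `G^f(Y, f(x₀))`, as a subset of `π₁(Y, f(x₀))`. -/
def gottlieb (f : C(X, Y)) (x₀ : X) : Set (FundamentalGroup Y (f x₀)) :=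
  {a | ∃ (α : C(UnitAddCircle, Y)) (hα : f x₀ = α 0),
    FundamentalGroup.fromPath (Path.Homotopic.Quotient.mk ((circleLoop α).cast hα hα)) = a ∧
      ∃ F : C(X × UnitAddCircle, Y), ExtendsWedge f x₀ α F}

end Gottlieb

/-! ### Whitehead products and the generalized Whitehead center group -/

section Whitehead

/-- The corner `0` of the cube, as base-point of the sphere `∂I^K`. -/
def corner (K : Type) [Nonempty K] : Cube.boundary K :=
  ⟨fun _ => 0, Classical.arbitrary K, Or.inl rfl⟩

/-- Base-point preserving maps `∂I^K → Y`. -/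
def SphereMap (K : Type) [Nonempty K] (Y : Type v) [TopologicalSpace Y] (y : Y) : Type v :=
  {g : C(Cube.boundary K, Y) // g (corner K) = y}

/-- Base-point preserving homotopy of maps `∂I^K → Y`. -/
instance sphereSetoid (K : Type) [Nonempty K] (Y : Type v) [TopologicalSpace Y] (y : Y) :
    Setoid (SphereMap K Y y) where
  r g g' := g.1.HomotopicRel g'.1 {corner K}
  iseqv := ⟨fun g => .refl g.1, fun h => h.symm, fun h h' => h.trans h'⟩

/-- Pointed homotopy classes of maps from the sphere `∂I^K` to `(Y, y)`: the set underlying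
`π_{k-1}(Y, y)`, where `k` is the number of elements of `K`. -/
def SphereClass (K : Type) [Nonempty K] (Y : Type v) [TopologicalSpace Y] (y : Y) : Type v :=
  Quotient (sphereSetoid K Y y)

/-- The class of the constant map, the neutral element of `π_{k-1}(Y, y)`. -/
def SphereClass.trivial (K : Type) [Nonempty K] (Y : Type v) [TopologicalSpace Y] (y : Y) :
    SphereClass K Y y :=
  Quotient.mk _ ⟨.const _ y, rfl⟩

theorem isClosed_boundary (M : Type) [Finite M] : IsClosed (Cube.boundary M) := by
  have h : Cube.boundary M = ⋃ i : M, {s : M → I | s i = 0 ∨ s i = 1} := by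
    ext s
    simp [Cube.boundary]
  rw [h]
  refine isClosed_iUnion_of_finite fun i => ?_
  exact (isClosed_eq (continuous_apply i) continuous_const).union
    (isClosed_eq (continuous_apply i) continuous_const)

variable {M N : Type} {Y : Type v}

open Classical in
/-- The map on `∂(I^M × I^N) = I^M × ∂I^N ∪ ∂I^M × I^N` given by `b` on `I^M × ∂I^N` and by `a` on
`∂I^M × I^N`. -/
def glue (b : (M → I) → Y) (a : (N → I) → Y) (s : Cube.boundary (M ⊕ N)) : Y :=
  if s.1 ∘ Sum.inr ∈ Cube.boundary N then b (s.1 ∘ Sum.inl) else a (s.1 ∘ Sum.inr)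

theorem glue_of_right (b : (M → I) → Y) (a : (N → I) → Y) (s : Cube.boundary (M ⊕ N))
    (hs : s.1 ∘ Sum.inr ∈ Cube.boundary N) : glue b a s = b (s.1 ∘ Sum.inl) :=
  if_pos hs

theorem glue_of_left {b : (M → I) → Y} {a : (N → I) → Y} {y : Y}
    (hb : ∀ s ∈ Cube.boundary M, b s = y) (ha : ∀ s ∈ Cube.boundary N, a s = y)
    (s : Cube.boundary (M ⊕ N)) (hs : s.1 ∘ Sum.inl ∈ Cube.boundary M) :
    glue b a s = a (s.1 ∘ Sum.inr) := by
  by_cases h : s.1 ∘ Sum.inr ∈ Cube.boundary N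
  · rw [glue_of_right b a s h, hb _ hs, ha _ h]
  · exact if_neg h

theorem continuous_glue [Finite M] [Finite N] [TopologicalSpace Y] {T : Type}
    [TopologicalSpace T] {y : Y} (b : C(T × (M → I), Y)) (a : C(T × (N → I), Y))
    (hb : ∀ t, ∀ s ∈ Cube.boundary M, b (t, s) = y)
    (ha : ∀ t, ∀ s ∈ Cube.boundary N, a (t, s) = y) :
    Continuous fun p : T × Cube.boundary (M ⊕ N) =>
      glue (fun s => b (p.1, s)) (fun s => a (p.1, s)) p.2 := by
  have cl : Continuous fun p : T × Cube.boundary (M ⊕ N) => p.2.1 ∘ (Sum.inl : M → M ⊕ N) := by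
    exact continuous_pi fun i => (continuous_apply (Sum.inl i)).comp
      (continuous_subtype_val.comp continuous_snd)
  have cr : Continuous fun p : T × Cube.boundary (M ⊕ N) => p.2.1 ∘ (Sum.inr : N → M ⊕ N) := by
    exact continuous_pi fun i => (continuous_apply (Sum.inr i)).comp
      (continuous_subtype_val.comp continuous_snd)
  have h1 := (isClosed_boundary N).preimage cr
  have h2 := (isClosed_boundary M).preimage cl
  rw [← continuousOn_univ]
  have hU : (Set.univ : Set (T × Cube.boundary (M ⊕ N))) =
      (fun p : T × Cube.boundary (M ⊕ N) => p.2.1 ∘ (Sum.inr : N → M ⊕ N)) ⁻¹' Cube.boundary N ∪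
      (fun p : T × Cube.boundary (M ⊕ N) => p.2.1 ∘ (Sum.inl : M → M ⊕ N)) ⁻¹' Cube.boundary M := by
    refine (Set.eq_univ_of_forall fun p => ?_).symm
    rcases Cube.boundary_sum_iff.mp p.2.2 with h | h
    · exact Or.inr h
    · exact Or.inl h
  rw [hU]
  refine ContinuousOn.union_of_isClosed ?_ ?_ h1 h2
  · refine ContinuousOn.congr (f := fun p : T × Cube.boundary (M ⊕ N) => b (p.1, p.2.1 ∘ Sum.inl))
      (b.continuous.comp (continuous_fst.prodMk cl)).continuousOn ?_
    intro p hp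
    exact glue_of_right _ _ _ hp
  · refine ContinuousOn.congr (f := fun p : T × Cube.boundary (M ⊕ N) => a (p.1, p.2.1 ∘ Sum.inr))
      (a.continuous.comp (continuous_fst.prodMk cr)).continuousOn ?_
    intro p hp
    exact glue_of_left (hb p.1) (ha p.1) _ hp

variable [TopologicalSpace Y] {y : Y}

/-- The map `∂(I^M × I^N) → Y` whose pointed homotopy class is the Whitehead product of the classes
of `b : (I^M, ∂I^M) → (Y, y)` and `a : (I^N, ∂I^N) → (Y, y)`. -/
def whiteheadMap [Finite M] [Finite N] [Nonempty M] [Nonempty N]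
    (b : GenLoop M Y y) (a : GenLoop N Y y) : SphereMap (M ⊕ N) Y y :=
  ⟨⟨glue b a, (continuous_glue (T := Unit) (b.1.comp .snd) (a.1.comp .snd)
      (fun _ => b.2) (fun _ => a.2)).comp (continuous_const (y := ()) |>.prodMk continuous_id)⟩,
    (glue_of_right _ _ _ ⟨Classical.arbitrary N, Or.inl rfl⟩).trans
      (b.2 _ ⟨Classical.arbitrary M, Or.inl rfl⟩)⟩

theorem whiteheadMap_homotopic [Finite M] [Finite N] [Nonempty M] [Nonempty N]
    {b b' : GenLoop M Y y} {a a' : GenLoop N Y y} (hb : GenLoop.Homotopic b b')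
    (ha : GenLoop.Homotopic a a') : whiteheadMap b a ≈ whiteheadMap b' a' := by
  obtain ⟨B⟩ := hb
  obtain ⟨A⟩ := ha
  have hB : ∀ t : I, ∀ s ∈ Cube.boundary M, B (t, s) = y :=
    fun t s hs => (B.eq_fst t hs).trans (b.2 s hs)
  have hA : ∀ t : I, ∀ s ∈ Cube.boundary N, A (t, s) = y :=
    fun t s hs => (A.eq_fst t hs).trans (a.2 s hs)
  refine ⟨⟨⟨⟨fun p => glue (fun s => B (p.1, s)) (fun s => A (p.1, s)) p.2,
    continuous_glue B.toContinuousMap A.toContinuousMap hB hA⟩, ?_, ?_⟩, ?_⟩⟩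
  · intro s
    change glue (fun s => B (0, s)) (fun s => A (0, s)) s = glue b a s
    simp only [ContinuousMap.HomotopyWith.apply_zero]
    rfl
  · intro s
    change glue (fun s => B (1, s)) (fun s => A (1, s)) s = glue b' a' s
    simp only [ContinuousMap.HomotopyWith.apply_one]
    rfl
  · intro t s hs
    rw [Set.mem_singleton_iff] at hs
    subst hs
    refine Eq.trans ?_ (whiteheadMap b a).2.symm
    exact (glue_of_right (fun s => B (t, s)) (fun s => A (t, s)) (corner (M ⊕ N))
      ⟨Classical.arbitrary N, Or.inl rfl⟩).trans (hB t _ ⟨Classical.arbitrary M, Or.inl rfl⟩)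

/-- The Whitehead product `[b, a]` of `b ∈ π_m(Y, y)` and `a ∈ π_n(Y, y)`, `m, n ≥ 1`, where `m` and
`n` are the numbers of elements of `M` and `N`; it is an element of `π_{m+n-1}(Y, y)`. -/
def whiteheadProduct [Finite M] [Finite N] [Nonempty M] [Nonempty N]
    (b : HomotopyGroup M Y y) (a : HomotopyGroup N Y y) : SphereClass (M ⊕ N) Y y :=
  Quotient.map₂ whiteheadMap (fun _ _ hb _ _ ha => whiteheadMap_homotopic hb ha) b a

variable {X : Type u} [TopologicalSpace X]

/-- The map `π_m(X, x₀) → π_m(Y, f(x₀))` induced by `f`. -/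
def homotopyGroupMap (f : C(X, Y)) (x₀ : X) (b : HomotopyGroup M X x₀) :
    HomotopyGroup M Y (f x₀) :=
  Quotient.map (fun g : GenLoop M X x₀ =>
      (⟨f.comp g.1, fun s hs => congrArg f (g.2 s hs)⟩ : GenLoop M Y (f x₀)))
    (fun _ _ h => ContinuousMap.HomotopicRel.comp_continuousMap h f) b

/-- The generalized Whitehead center group `P^f(Y, f(x₀))`, as a subset of `π₁(Y, f(x₀))`. The
number `m = n + 1` ranges over all `m ≥ 1`. -/
def whiteheadCenter (f : C(X, Y)) (x₀ : X) : Set (FundamentalGroup Y (f x₀)) :=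
  {a | ∀ (n : ℕ) (β : HomotopyGroup.Pi (n + 1) X x₀),
    whiteheadProduct (homotopyGroupMap f x₀ β) (HomotopyGroup.pi1EquivFundamentalGroup.symm a) =
      SphereClass.trivial (Fin (n + 1) ⊕ Fin 1) Y (f x₀)}

end Whitehead

end GottliebDeck

end

open scoped unitInterval Topology ContinuousMap

noncomputable section

namespace GottliebDeck

universe u v w z

/-! ### Local path-connectedness of CW complexes -/

section CWComplex

/-! Both inclusions rest on homotopy lifting and uniqueness of lifts. Running `F` once round the
circle, corrected by the homotopy on `X`, gives a self-homotopy of `f`. Lifted from `f₀`, it ends at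
another lift of `f`, which must be `h ∘ f₀` for a deck transformation `h`. Every stage of the lift
intertwines `l` with `f_*(l)` as `f₀` does, so `h` commutes with `f_*(l)`; comparison with a lift of
`α` shows that `h` corresponds to `α` (`gottlieb_subset_image_homotopyDeck`).

For the second inclusion, a homotopy `H` from `f₀` to `h ∘ f₀`, composed with a lift of `β` and
projected by `q`, is a map on `I^m × I` equal to `f ∘ β` at both ends. If `m ≥ 2`, the lift is
constant on `∂I^m`, so the sides carry the loop of `h` and the Whitehead map extends over the cube.
If `m = 1`, one side is the track of `H` at `l x₀'` instead; centrality gives it the endpoints of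
`f_*(l)` applied to the track at `x₀'`, and simple connectivity of `Y'` fills the gap
(`image_homotopyDeck_subset_whiteheadCenter`).

Both use that deck groups are transitive on fibres (`exists_deck_apply_eq`). A base with merely the
homotopy type of a CW complex need not be locally path-connected, so the usual lifting criterion is
replaced by a transfer to the complex (`exists_fibrewise_map`). -/

theorem locallyPathConnectedSpace_of_cwComplex {K : Type u} [TopologicalSpace K] [T2Space K]
    [Topology.CWComplex (Set.univ : Set K)] : LocallyPathConnectedSpace K := by
  let Z := Σ c : (Σ n, Topology.RelCWComplex.cell (Set.univ : Set K) n),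
    Metric.closedBall (0 : Fin c.1 → ℝ) 1
  have hball : ∀ n, LocallyPathConnectedSpace (Metric.closedBall (0 : Fin n → ℝ) 1) := fun n =>
    (convex_closedBall (0 : Fin n → ℝ) 1).locallyPathConnectedSpace
  let π : Z → K := fun z => Topology.RelCWComplex.map (C := Set.univ) z.1.1 z.1.2 z.2.1
  have hπ : Continuous π := by
    refine continuous_sigma fun c => ?_
    exact (Topology.RelCWComplex.continuousOn (C := (Set.univ : Set K)) c.1 c.2).domRestrict
  have hsurj : Function.Surjective π := by
    intro k
    have hk : k ∈ ⋃ (n : ℕ) (j : Topology.RelCWComplex.cell (Set.univ : Set K) n),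
        Topology.RelCWComplex.closedCell n j := by
      rw [Topology.CWComplex.union]
      trivial
    obtain ⟨n, j, x, hx, rfl⟩ := by simpa only [Set.mem_iUnion] using hk
    exact ⟨⟨⟨n, j⟩, ⟨x, hx⟩⟩, rfl⟩
  -- Closedness is tested on closed cells, and each of these is the image of a compact ball in a
  -- Hausdorff space.
  have hq : Topology.IsQuotientMap π := by
    refine Topology.isQuotientMap_iff_isClosed.mpr ⟨hsurj, fun s => ⟨fun h => h.preimage hπ, ?_⟩⟩
    intro h
    rw [Topology.CWComplex.closed Set.univ s (Set.subset_univ s)]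
    intro n j
    have h1 := (isClosed_sigma_iff.mp h) ⟨n, j⟩
    have h2 := h1.isCompact.image (f := fun x => π ⟨⟨n, j⟩, x⟩) (hπ.comp continuous_sigmaMk)
    convert h2.isClosed using 1
    ext k
    constructor
    · rintro ⟨hk, x, hx, rfl⟩
      exact ⟨⟨x, hx⟩, hk, rfl⟩
    · rintro ⟨x, hx, rfl⟩
      exact ⟨hx, x.1, x.2, rfl⟩
  exact hq.locallyPathConnectedSpace

end CWComplex

/-! ### Transitivity of the deck group on fibres -/

section Transitive

variable {E : Type u} {B : Type v} [TopologicalSpace E] [TopologicalSpace B]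

/-- A fibrewise self-map of a simply connected covering space that takes paths to paths and a
prescribed point of a fibre to another one. -/
theorem exists_pathwise_deck [SimplyConnectedSpace E] {q : C(E, B)} (hq : IsCoveringMap q)
    {e₀ e₁ : E} (he : q e₀ = q e₁) :
    ∃ T : E → E, T e₀ = e₁ ∧ (∀ e, q (T e) = q e) ∧ ∀ c : C(I, E), Continuous (T ∘ c) := by
  let T : E → E := fun e => hq.liftPath (q.comp (PathConnectedSpace.somePath e₀ e).toContinuousMap)
    e₁ (by simp [he]) 1
  -- Simple connectivity makes `T e` independent of the path chosen to `e`.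
  have key : ∀ {e d : E} (γ : Path e₀ e) (Γ : Path e₁ d), (∀ t, q (Γ t) = q (γ t)) → T e = d := by
    intro e d γ Γ h
    have h1 : Γ.toContinuousMap = hq.liftPath (q.comp γ.toContinuousMap) e₁ (by simp [he]) :=
      (hq.eq_liftPath_iff' _).mpr ⟨funext h, Γ.source⟩
    have h2 : (q.comp (PathConnectedSpace.somePath e₀ e).toContinuousMap).HomotopicRel
        (q.comp γ.toContinuousMap) {0, 1} :=
      ContinuousMap.HomotopicRel.comp_continuousMap (SimplyConnectedSpace.paths_homotopic
        (PathConnectedSpace.somePath e₀ e) γ) q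
    have h3 := hq.liftPath_apply_one_eq_of_homotopicRel h2 e₁ (by simp [he]) (by simp [he])
    rw [← h1] at h3
    exact h3.trans Γ.target
  have lift : ∀ e, ∃ Γ : Path e₁ (T e),
      ∀ t, q (Γ t) = q (PathConnectedSpace.somePath e₀ e t) := fun e =>
    ⟨⟨_, hq.liftPath_zero _ _ (by simp [he]), rfl⟩,
      fun t => congrFun (hq.liftPath_lifts _ _ (by simp [he])) t⟩
  have hT : ∀ e, q (T e) = q e := fun e => by
    obtain ⟨Γ, hΓ⟩ := lift e
    simpa using hΓ 1
  refine ⟨T, key (Path.refl e₀) (Path.refl e₁) fun _ => he.symm, hT, fun c => ?_⟩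
  let L : C(I, E) := hq.liftPath (q.comp c) (T (c 0)) (hT (c 0)).symm
  have hL : ∀ t, q (L t) = q (c t) := fun t => congrFun (hq.liftPath_lifts _ _ _) t
  have hL0 : L 0 = T (c 0) := hq.liftPath_zero _ _ _
  -- Along `c`, `T` is computed by following a path to `c 0` and then an initial piece of `c`.
  suffices h : T ∘ c = L by
    rw [h]
    exact L.continuous
  funext t
  obtain ⟨Γ, hΓ⟩ := lift (c 0)
  let ct : Path (c 0) (c t) := ⟨⟨fun s => c (s * t), by fun_prop⟩, by simp, by simp⟩
  let Lt : Path (T (c 0)) (L t) := ⟨⟨fun s => L (s * t), by fun_prop⟩, by simp [hL0], by simp⟩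
  refine key ((PathConnectedSpace.somePath e₀ (c 0)).trans ct) (Γ.trans Lt) fun s => ?_
  simp only [Path.trans_apply]
  split_ifs
  · exact hΓ _
  · exact hL _

/-- A fibrewise map taking paths to paths becomes continuous after precomposition with a map whose
projection to the base factors through a locally path-connected space. -/
theorem continuous_comp_of_pathwise {q : C(E, B)} (hq : IsCoveringMap q) {T : E → E}
    (hT : ∀ e, q (T e) = q e) (hc : ∀ c : C(I, E), Continuous (T ∘ c))
    {A : Type*} {K : Type*} [TopologicalSpace A] [TopologicalSpace K] [LocallyPathConnectedSpace K]
    (g : C(A, E)) (φ : C(A, K)) (ψ : C(K, B)) (h : ∀ a, q (g a) = ψ (φ a)) :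
    Continuous (T ∘ g) := by
  refine continuous_iff_continuousAt.mpr fun a => ?_
  obtain ⟨s₁, hs₁, h₁⟩ := hq.isLocalHomeomorph (g a)
  obtain ⟨s₂, hs₂, h₂⟩ := hq.isLocalHomeomorph (T (g a))
  have e₁ : ∀ e, s₁ e = q e := fun e => (congrFun h₁ e).symm
  have e₂ : ∀ e, s₂ e = q e := fun e => (congrFun h₂ e).symm
  have m₁ : ψ (φ a) ∈ s₁.target := by rw [← h, ← e₁]; exact s₁.map_source hs₁
  have m₂ : ψ (φ a) ∈ s₂.target := by rw [← h, ← hT, ← e₂]; exact s₂.map_source hs₂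
  have hcont : ContinuousAt (fun x => s₂.symm (ψ (φ x))) a :=
    ContinuousAt.comp (f := fun x => ψ (φ x)) (s₂.continuousAt_symm m₂)
      (ψ.comp φ).continuous.continuousAt
  refine hcont.congr ?_
  -- Near `a`, `T ∘ g` equals the local section through `T (g a)`: a path in `V` lifts through both
  -- sections, and `T` carries the first lift to the second by uniqueness.
  obtain ⟨V, ⟨hV, hVc⟩, hVs⟩ := (LocallyPathConnectedSpace.path_connected_basis (φ a)).mem_iff.mp
    (((s₁.open_target.inter s₂.open_target).preimage ψ.continuous).mem_nhds ⟨m₁, m₂⟩)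
  filter_upwards [φ.continuous.continuousAt hV,
    g.continuous.continuousAt (s₁.open_source.mem_nhds hs₁)] with x hx hgx
  obtain ⟨γ, hγ⟩ := hVc.joinedIn _ (mem_of_mem_nhds hV) _ hx
  have c₁ : Continuous fun t => s₁.symm (ψ (γ t)) :=
    s₁.continuousOn_symm.comp_continuous (ψ.continuous.comp γ.continuous)
      fun t => (hVs (hγ t)).1
  have c₂ : Continuous fun t => s₂.symm (ψ (γ t)) :=
    s₂.continuousOn_symm.comp_continuous (ψ.continuous.comp γ.continuous)
      fun t => (hVs (hγ t)).2
  have i₁ : s₁.symm (ψ (γ 0)) = g a := by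
    rw [γ.source, ← h, ← e₁, s₁.left_inv hs₁]
  have j₁ : s₁.symm (ψ (γ 1)) = g x := by
    rw [γ.target, ← h, ← e₁, s₁.left_inv hgx]
  have i₂ : s₂.symm (ψ (γ 0)) = T (g a) := by
    rw [γ.source, ← h, ← hT, ← e₂, s₂.left_inv hs₂]
  have := hq.eq_of_comp_eq (hc ⟨_, c₁⟩) c₂ (by
    funext t
    simp only [Function.comp_apply, hT, ContinuousMap.coe_mk]
    rw [← e₁, ← e₂, s₁.right_inv (hVs (hγ t)).1, s₂.right_inv (hVs (hγ t)).2]) 0 (by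
    simp only [Function.comp_apply, ContinuousMap.coe_mk, i₁, i₂])
  have h1 := congrFun this 1
  simp only [Function.comp_apply, ContinuousMap.coe_mk] at h1
  rw [j₁, γ.target] at h1
  exact h1.symm

/-- The pathwise `T` is in fact continuous. Push `E` along the lift `R` of a homotopy from the
identity of `B` to a map through the complex `K`; after this push `T` is continuous. Lifting the
reversed homotopy from there ends at `T`, by uniqueness of path lifts. -/
theorem exists_fibrewise_map [SimplyConnectedSpace E] (hB : HasCWHomotopyType B) {q : C(E, B)}
    (hq : IsCoveringMap q) {e₀ e₁ : E} (he : q e₀ = q e₁) :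
    ∃ T : C(E, E), T e₀ = e₁ ∧ ∀ e, q (T e) = q e := by
  obtain ⟨K, _, _, ⟨_⟩, ⟨Φ⟩⟩ := hB
  have := locallyPathConnectedSpace_of_cwComplex (K := K)
  obtain ⟨T, hT0, hT, hc⟩ := exists_pathwise_deck hq he
  obtain ⟨H⟩ := Φ.left_inv.symm
  let R : C(I × E, E) := hq.liftHomotopy (H.toContinuousMap.comp ((ContinuousMap.id I).prodMap q))
    (.id E) fun e => H.apply_zero (q e)
  have hR : ∀ t e, q (R (t, e)) = H (t, q e) := fun t e =>
    congrFun (hq.liftHomotopy_lifts _ _ _) (t, e)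
  have hR0 : ∀ e, R (0, e) = e := fun e => hq.liftHomotopy_zero _ _ _ e
  have hcont : Continuous (T ∘ fun e => R (1, e)) :=
    continuous_comp_of_pathwise hq hT hc (R.comp (.prodMk (.const E 1) (.id E)))
      (Φ.toFun.comp q) Φ.invFun fun e => (hR 1 e).trans (H.apply_one (q e))
  let S : C(I × E, E) := hq.liftHomotopy
    (H.toContinuousMap.comp (((⟨σ, unitInterval.continuous_symm⟩ : C(I, I))).prodMap q))
    ⟨_, hcont⟩ fun e => by simp [hT, hR]
  have hS : ∀ t e, q (S (t, e)) = H (σ t, q e) := fun t e =>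
    congrFun (hq.liftHomotopy_lifts _ _ _) (t, e)
  have hS0 : ∀ e, S (0, e) = T (R (1, e)) := fun e => hq.liftHomotopy_zero _ _ _ e
  have key : ∀ e, S (1, e) = T e := fun e => by
    have h := hq.eq_of_comp_eq (g₁ := fun t => S (t, e))
      (g₂ := T ∘ fun t => R (σ t, e)) (by fun_prop)
      (hc ⟨fun t => R (σ t, e), by fun_prop⟩)
      (by funext t; simp [hT, hR, hS]) 0 (by simp [hS0])
    have h1 := congrFun h 1
    simpa [hR0] using h1
  exact ⟨⟨fun e => S (1, e), by fun_prop⟩, (key e₀).trans hT0,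
    fun e => (congrArg q (key e)).trans (hT e)⟩

theorem deck_ext [PreconnectedSpace E] {q : C(E, B)} (hq : IsCoveringMap q) {h k : Deck q} (e : E)
    (he : h.1 e = k.1 e) : h = k := by
  refine Subtype.ext (Homeomorph.ext (congrFun (hq.eq_of_comp_eq h.1.continuous k.1.continuous
    (funext fun x => ?_) e he)))
  exact (h.2 x).trans (k.2 x).symm

/-- Fibrewise maps in the two directions are mutually inverse, as their composites are lifts of `q`
fixing a point. -/
theorem exists_deck_apply_eq [SimplyConnectedSpace E] (hB : HasCWHomotopyType B) {q : C(E, B)}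
    (hq : IsCoveringMap q) {e₀ e₁ : E} (he : q e₀ = q e₁) : ∃ h : Deck q, h.1 e₀ = e₁ := by
  obtain ⟨S, hS0, hS⟩ := exists_fibrewise_map hB hq he
  obtain ⟨T, hT0, hT⟩ := exists_fibrewise_map hB hq he.symm
  have h₁ : T ∘ S = id := hq.eq_of_comp_eq (T.comp S).continuous continuous_id
    (funext fun x => by simp [hS, hT]) e₀ (by simp [hS0, hT0])
  have h₂ : S ∘ T = id := hq.eq_of_comp_eq (S.comp T).continuous continuous_id
    (funext fun x => by simp [hS, hT]) e₁ (by simp [hS0, hT0])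
  exact ⟨⟨⟨⟨S, T, congrFun h₁, congrFun h₂⟩, S.continuous, T.continuous⟩, hS⟩, hS0⟩

end Transitive

/-! ### Deck transformations and loop classes -/

section LoopClass

variable {E : Type u} {B : Type v} [TopologicalSpace E] [TopologicalSpace B]

/-- Homotopic loops have lifts with the same endpoint, and any path in `E` may be used to compute
the class. -/
theorem deckLoopClass_eq_iff [SimplyConnectedSpace E] {q : C(E, B)} (hq : IsCoveringMap q)
    {e₀ : E} {b₀ : B} (hb : q e₀ = b₀) (h : Deck q) (α : Path b₀ b₀) :
    deckLoopClass q e₀ b₀ hb h = FundamentalGroup.fromPath (Path.Homotopic.Quotient.mk α) ↔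
      ∃ Γ : Path e₀ (h.1 e₀), ∀ t, q (Γ t) = α t := by
  constructor
  · intro heq
    let γ := PathConnectedSpace.somePath e₀ (h.1 e₀)
    let γ' : Path b₀ b₀ := (γ.map q.continuous).cast hb.symm ((h.2 e₀).trans hb).symm
    have h1 : γ'.Homotopic α := Quotient.exact heq
    have h2 := hq.liftPath_apply_one_eq_of_homotopicRel h1 e₀ (by simp [hb]) (by simp [hb])
    have h3 : γ.toContinuousMap = hq.liftPath γ'.toContinuousMap e₀ (by simp [hb]) :=
      (hq.eq_liftPath_iff' _).mpr ⟨rfl, γ.source⟩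
    rw [← h3] at h2
    refine ⟨⟨hq.liftPath α.toContinuousMap e₀ (by simp [hb]), hq.liftPath_zero _ _ _,
      h2.symm.trans γ.target⟩, fun t => congrFun (hq.liftPath_lifts _ _ (by simp [hb])) t⟩
  · rintro ⟨Γ, hΓ⟩
    rw [deckLoopClass_eq q e₀ b₀ hb h Γ]
    congr 2
    ext t
    exact hΓ t

theorem deckLoopClass_injective [SimplyConnectedSpace E] {q : C(E, B)} (hq : IsCoveringMap q)
    {e₀ : E} {b₀ : B} (hb : q e₀ = b₀) : Function.Injective (deckLoopClass q e₀ b₀ hb) := by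
  intro h k hhk
  obtain ⟨Γ, hΓ⟩ := (deckLoopClass_eq_iff hq hb h _).mp hhk
  let γ := PathConnectedSpace.somePath e₀ (k.1 e₀)
  have := hq.eq_of_comp_eq Γ.continuous γ.continuous (funext hΓ) 0 (by simp)
  refine deck_ext hq e₀ ?_
  simpa using congrFun this 1

theorem deckLoopClass_surjective [SimplyConnectedSpace E] (hB : HasCWHomotopyType B) {q : C(E, B)}
    (hq : IsCoveringMap q) {e₀ : E} {b₀ : B} (hb : q e₀ = b₀) :
    Function.Surjective (deckLoopClass q e₀ b₀ hb) := by
  intro a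
  obtain ⟨α, rfl⟩ := Quotient.exists_rep a
  let Γ := hq.liftPath α.toContinuousMap e₀ (by simp [hb])
  have hΓ : ∀ t, q (Γ t) = α t := fun t => congrFun (hq.liftPath_lifts _ _ (by simp [hb])) t
  obtain ⟨h, hh⟩ := exists_deck_apply_eq hB hq (e₀ := e₀) (e₁ := Γ 1) (by rw [hΓ, hb, α.target])
  exact ⟨h, (deckLoopClass_eq_iff hq hb h α).mpr ⟨⟨Γ, hq.liftPath_zero _ _ _, hh.symm⟩, hΓ⟩⟩

end LoopClass

/-! ### Induced deck transformations and the Gottlieb inclusion -/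

section Induced

variable {X : Type u} {Y : Type v} {X' : Type w} {Y' : Type z}
  [TopologicalSpace X] [TopologicalSpace Y] [TopologicalSpace X'] [TopologicalSpace Y']

theorem existsUnique_isInduced [SimplyConnectedSpace X'] [SimplyConnectedSpace Y']
    (hY : HasCWHomotopyType Y) {p : C(X', X)} {q : C(Y', Y)} (hq : IsCoveringMap q)
    {f : C(X, Y)} {f₀ : C(X', Y')} (hf₀ : IsLifting p q f f₀) (l : Deck p) :
    ∃! k : Deck q, IsInduced f₀ l k := by
  have hl : ∀ x, q (f₀ (l.1 x)) = q (f₀ x) := fun x => by rw [hf₀, hf₀, l.2]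
  obtain ⟨x⟩ := (inferInstance : Nonempty X')
  obtain ⟨k, hk⟩ := exists_deck_apply_eq hY hq (hl x).symm
  refine ⟨k, congrFun (hq.eq_of_comp_eq (f₀.continuous.comp l.1.continuous)
    (k.1.continuous.comp f₀.continuous) (funext fun y => ?_) x hk.symm), fun k' hk' => ?_⟩
  · exact (hl y).trans (k.2 _).symm
  · exact deck_ext hq (f₀ x) ((hk' x).symm.trans hk.symm)

/-- Equivariance of the lift of a homotopy propagates from one time to all times. -/
theorem equivariant_of_equivariant_at {p : C(X', X)} {q : C(Y', Y)} (hq : IsCoveringMap q)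
    {M : I × X → Y} {G : C(I × X', Y')} (hG : ∀ t x, q (G (t, x)) = M (t, p x))
    (l : Deck p) (k : Deck q) (t₀ : I) (h : ∀ x, G (t₀, l.1 x) = k.1 (G (t₀, x))) (t : I) (x : X') :
    G (t, l.1 x) = k.1 (G (t, x)) := by
  have hk := k.1.continuous
  refine congrFun (hq.eq_of_comp_eq (g₁ := fun t => G (t, l.1 x)) (g₂ := fun t => k.1 (G (t, x)))
    (by fun_prop) (by fun_prop) (funext fun s => ?_) t₀ (h x)) t
  simp only [Function.comp_apply, hG, l.2 x]
  rw [k.2, hG]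

/-- Lifting of a homotopy of maps out of `X` along `p` and `q`, starting from any lift at time `0`. -/
theorem exists_lift_homotopy (p : C(X', X)) {q : C(Y', Y)} (hq : IsCoveringMap q)
    (M : C(I × X, Y)) (g : C(X', Y')) (hg : ∀ x, q (g x) = M (0, p x)) :
    ∃ G : C(I × X', Y'), (∀ t x, q (G (t, x)) = M (t, p x)) ∧ ∀ x, G (0, x) = g x :=
  ⟨hq.liftHomotopy (M.comp ((ContinuousMap.id I).prodMap p)) g fun x => (hg x).symm,
    fun t x => congrFun (hq.liftHomotopy_lifts _ _ fun x => (hg x).symm) (t, x),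
    hq.liftHomotopy_zero _ _ _⟩

theorem gottlieb_subset_image_homotopyDeck [SimplyConnectedSpace X'] [SimplyConnectedSpace Y']
    (hY : HasCWHomotopyType Y) {p : C(X', X)} {q : C(Y', Y)} (hq : IsCoveringMap q)
    {f : C(X, Y)} {f₀ : C(X', Y')} (hf₀ : IsLifting p q f f₀) {x₀ : X} {x₀' : X'}
    (hx₀ : p x₀' = x₀) (hb : q (f₀ x₀') = f x₀) :
    gottlieb f x₀ ⊆ deckLoopClass q (f₀ x₀') (f x₀) hb '' homotopyDeck p q f₀ := by
  rintro _ ⟨α, hα, rfl, F, K, L, hKL⟩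
  let M : C(I × X, Y) := F.comp ⟨fun a => (a.2, ((a.1 : ℝ) : UnitAddCircle)),
    continuous_snd.prodMk ((AddCircle.continuous_mk' (1 : ℝ)).comp
      (continuous_subtype_val.comp continuous_fst))⟩
  have circle_one : (((1 : I) : ℝ) : UnitAddCircle) = 0 := AddCircle.coe_period 1
  have circle_zero : (((0 : I) : ℝ) : UnitAddCircle) = 0 := by simp
  have hM0 : ∀ x, M (0, x) = F (x, 0) := fun x => congrArg (fun c => F (x, c)) circle_zero
  have hM1 : ∀ x, M (1, x) = F (x, 0) := fun x => congrArg (fun c => F (x, c)) circle_one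
  have hK0 : ∀ x, K (0, x) = F (x, 0) := K.apply_zero
  have hK1 : ∀ x, K (1, x) = f x := K.apply_one
  have hL0 : ∀ s, L (0, s) = F (x₀, s) := L.apply_zero
  have hL1 : ∀ s, L (1, s) = α s := L.apply_one
  -- As `F` restricts to `f` only up to homotopy, the self-homotopy of `f` has three stages: `K`
  -- reversed, `F` round the circle, then `K`. Their successive lifts are `A`, `G`, `C`.
  let Kr : C(I × X, Y) := K.toContinuousMap.comp
    ((⟨σ, unitInterval.continuous_symm⟩ : C(I, I)).prodMap (.id X))
  have hKr : ∀ t x, Kr (t, x) = K (σ t, x) := fun _ _ => rfl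
  obtain ⟨A, hA, hA0⟩ := exists_lift_homotopy p hq Kr f₀ fun x => by
    rw [hKr, unitInterval.symm_zero, hK1, hf₀]
  obtain ⟨G, hG, hG0⟩ := exists_lift_homotopy p hq M (A.comp (.prodMk (.const X' 1) (.id X')))
    fun x => by
      change q (A (1, x)) = _
      rw [hA, hKr, unitInterval.symm_one, hK0, hM0]
  obtain ⟨C, hC, hC0⟩ := exists_lift_homotopy p hq K.toContinuousMap
    (G.comp (.prodMk (.const X' 1) (.id X'))) fun x => by
      change q (G (1, x)) = K (0, p x)
      rw [hG, hM1, hK0]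
  replace hG0 : ∀ x, G (0, x) = A (1, x) := hG0
  replace hC0 : ∀ x, C (0, x) = G (1, x) := hC0
  replace hC : ∀ t x, q (C (t, x)) = K (t, p x) := hC
  -- the lift of `L`, the circle direction being the direction of lifting
  let N : C(I × I, Y) := L.toContinuousMap.comp ⟨fun a => (a.2, ((a.1 : ℝ) : UnitAddCircle)),
    continuous_snd.prodMk ((AddCircle.continuous_mk' (1 : ℝ)).comp
      (continuous_subtype_val.comp continuous_fst))⟩
  have hN : ∀ s t, N (s, t) = L (t, ((s : ℝ) : UnitAddCircle)) := fun _ _ => rfl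
  obtain ⟨D, hD, hD0⟩ := exists_lift_homotopy (.id I) hq N
    ⟨fun t => A (σ t, x₀'), by fun_prop⟩ fun t => by
      change q (A (σ t, x₀')) = L (t, _)
      rw [hA, hKr, unitInterval.symm_symm, circle_zero, hx₀, hKL]
  replace hD0 : ∀ t, D (0, t) = A (σ t, x₀') := hD0
  replace hD : ∀ s t, q (D (s, t)) = L (t, ((s : ℝ) : UnitAddCircle)) := hD
  -- Three sides of the square `D` are the tracks of `x₀'` under `A` (reversed), `G` and `C`; the
  -- fourth, `D (·, 1)`, is then a lift of `α` from `f₀ x₀'` to `h (f₀ x₀')`.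
  have hDG : ∀ s, D (s, 0) = G (s, x₀') := congrFun (hq.eq_of_comp_eq
    (g₁ := fun s => D (s, 0)) (g₂ := fun s => G (s, x₀')) (by fun_prop) (by fun_prop)
    (funext fun s => by
      simp only [Function.comp_apply]
      rw [hD, hG, hL0, hx₀]
      rfl) 0 (by simp only [hD0, hG0, unitInterval.symm_zero]))
  have hDC : ∀ t, D (1, t) = C (t, x₀') := congrFun (hq.eq_of_comp_eq
    (g₁ := fun t => D (1, t)) (g₂ := fun t => C (t, x₀')) (by fun_prop) (by fun_prop)
    (funext fun t => by
      simp only [Function.comp_apply]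
      rw [hD, hC, circle_one, hx₀, hKL]) 0 (by simp only [hDG, hC0]))
  have hC1 : ∀ x, q (C (1, x)) = q (f₀ x) := fun x => by rw [hC, hK1, hf₀]
  obtain ⟨h, hh⟩ := exists_deck_apply_eq hY hq (hC1 x₀').symm
  have hf1 : ∀ x, C (1, x) = h.1 (f₀ x) := congrFun (hq.eq_of_comp_eq
    (g₁ := fun x => C (1, x)) (g₂ := fun x => h.1 (f₀ x)) (by fun_prop)
    (h.1.continuous.comp f₀.continuous)
    (funext fun x => (hC1 x).trans (h.2 _).symm) x₀' hh.symm)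
  refine ⟨h, ⟨?_, ?_⟩, (deckLoopClass_eq_iff hq hb h _).mpr ⟨⟨⟨fun s => D (s, 1), by fun_prop⟩,
    ?_, ?_⟩, ?_⟩⟩
  · rw [Subgroup.mem_centralizer_iff]
    rintro k ⟨l, hl⟩
    have e1 := equivariant_of_equivariant_at hq hA l k 0 (fun x => by rw [hA0, hA0, hl])
    have e2 := equivariant_of_equivariant_at hq hG l k 0 (fun x => by rw [hG0, hG0, e1])
    have e3 := equivariant_of_equivariant_at (M := K) hq hC l k 0
      (fun x => by rw [hC0, hC0, e2])
    refine deck_ext hq (f₀ x₀') ?_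
    change k.1 (h.1 (f₀ x₀')) = h.1 (k.1 (f₀ x₀'))
    rw [← hf1, ← e3, hf1, hl]
  · have r1 : f₀.Homotopic (A.comp (.prodMk (.const X' 1) (.id X'))) := ⟨⟨A, hA0, fun _ => rfl⟩⟩
    have r2 : (A.comp (.prodMk (.const X' 1) (.id X'))).Homotopic
      (G.comp (.prodMk (.const X' 1) (.id X'))) := ⟨⟨G, hG0, fun _ => rfl⟩⟩
    have r3 : (G.comp (.prodMk (.const X' 1) (.id X'))).Homotopic ((h.1 : C(Y', Y')).comp f₀) :=
      ⟨⟨C, hC0, hf1⟩⟩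
    exact (r1.trans r2).trans r3
  · change D (0, 1) = _
    rw [hD0, unitInterval.symm_one, hA0]
  · change D (1, 1) = _
    rw [hDC, hf1]
  · intro s
    change q (D (s, 1)) = α ((s : ℝ) : UnitAddCircle)
    rw [hD, hL1]

end Induced

/-! ### Null-homotopies from extensions over the cube -/

section Sphere

variable {Y : Type v} [TopologicalSpace Y] {y : Y}

theorem sphereClass_eq_trivial {K : Type} [Nonempty K] (g : SphereMap K Y y) (Φ : C(K → I, Y))
    (h : ∀ s : Cube.boundary K, Φ s = g.1 s) :
    (Quotient.mk _ g : SphereClass K Y y) = SphereClass.trivial K Y y := by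
  have h0 : Φ (fun _ => 0) = y := (h (corner K)).trans g.2
  -- The cube is contracted linearly to the corner `0`, which stays fixed, so the homotopy is
  -- pointed.
  refine Quotient.sound ⟨⟨⟨⟨fun a => Φ fun i => σ a.1 * a.2.1 i, ?_⟩, fun s => ?_, fun s => ?_⟩,
    fun t s hs => ?_⟩⟩
  · exact Φ.continuous.comp (continuous_pi fun i =>
      (unitInterval.continuous_symm.comp continuous_fst).mul
        ((continuous_apply i).comp (continuous_subtype_val.comp continuous_snd)))
  · simpa using h s
  · simpa using h0
  · rw [Set.mem_singleton_iff] at hs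
    subst hs
    simpa [corner, h0] using g.2.symm

theorem whiteheadProduct_eq_trivial {M : Type} [Finite M] [Nonempty M] (b : GenLoop M Y y)
    (a : Path y y) (Φ : C((M → I) × I, Y)) (h0 : ∀ s, Φ (s, 0) = b s) (h1 : ∀ s, Φ (s, 1) = b s)
    (hs : ∀ s ∈ Cube.boundary M, ∀ t, Φ (s, t) = a t) :
    whiteheadProduct (Quotient.mk _ b : HomotopyGroup M Y y)
      (HomotopyGroup.pi1EquivFundamentalGroup.symm
        (FundamentalGroup.fromPath (Path.Homotopic.Quotient.mk a))) =
      SphereClass.trivial (M ⊕ Fin 1) Y y := by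
  refine sphereClass_eq_trivial (whiteheadMap b ((genLoopEquivOfUnique (Fin 1)).symm a))
    (Φ.comp ⟨fun s => (fun i => s (Sum.inl i), s (Sum.inr 0)), by fun_prop⟩) fun s => ?_
  change Φ (s.1 ∘ Sum.inl, s.1 (Sum.inr 0)) = glue b _ s
  by_cases hr : s.1 ∘ Sum.inr ∈ Cube.boundary (Fin 1)
  · rw [glue_of_right _ _ _ hr]
    obtain ⟨i, hi⟩ := hr
    obtain rfl : i = 0 := Subsingleton.elim _ _
    rcases hi with hi | hi
    · rw [show s.1 (Sum.inr 0) = 0 from hi, h0]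
    · rw [show s.1 (Sum.inr 0) = 1 from hi, h1]
  · have hl := (Cube.boundary_sum_iff.mp s.2).resolve_right hr
    rw [hs _ hl]
    exact (if_neg hr).symm

end Sphere

/-! ### Lifting maps of cubes -/

section Boundary

/-- A map from a cube of dimension at least two to a covering space whose projection to the base is
constant on the boundary is itself constant on the boundary. -/
theorem eq_apply_zero_of_mem_boundary {M : Type} [DecidableEq M] [Nontrivial M] {E : Type u} {B : Type v}
    [TopologicalSpace E] [TopologicalSpace B] {p : C(E, B)} (hp : IsCoveringMap p) {b : B}
    (g : C(M → I, E)) (hg : ∀ s ∈ Cube.boundary M, p (g s) = b) (s : M → I)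
    (hs : s ∈ Cube.boundary M) : g s = g 0 := by
  have key : ∀ (c : I → M → I), Continuous c → (∀ t, c t ∈ Cube.boundary M) →
      g (c 1) = g (c 0) := fun c hc hcb =>
    hp.const_of_comp (g := fun t => g (c t)) (by fun_prop)
      (fun t t' => (hg _ (hcb t)).trans (hg _ (hcb t')).symm) 1 0
  obtain ⟨i, hi⟩ := hs
  obtain ⟨j, hij⟩ := exists_ne i
  -- Two legs inside the boundary join `0` to `s`: scaling the coordinates other than `i` keeps `s`
  -- on its face, and scaling coordinate `i` stays on the face where coordinate `j` is `0`.
  have h1 := key (fun t k => if k = i then s k else t * s k)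
    (continuous_pi fun k => by split_ifs <;> fun_prop) fun t => ⟨i, by simpa using hi⟩
  have h2 := key (fun t k => if k = i then t * s k else 0)
    (continuous_pi fun k => by split_ifs <;> fun_prop) fun t => ⟨j, by simp [hij]⟩
  have e1 : (fun k => if k = i then s k else 1 * s k) = s := by ext k; simp
  have e2 : (fun k => if k = i then s k else 0 * s k) =
      fun k => if k = i then 1 * s k else 0 := by ext k; simp
  have e3 : (fun k => if k = i then 0 * s k else (0 : I)) = (0 : M → I) := by
    ext k; simp
  rw [e1, e2] at h1
  rw [e3] at h2
  exact h1.trans h2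

/-- Maps from a cube lift through covering maps. -/
theorem exists_lift_cube {M : Type} [Finite M] {E : Type u} {B : Type v}
    [TopologicalSpace E] [TopologicalSpace B] {p : C(E, B)} (hp : IsCoveringMap p)
    (g : C(M → I, B)) (e : E) (he : p e = g 0) :
    ∃ G : C(M → I, E), G 0 = e ∧ ∀ s, p (G s) = g s := by
  -- Radial contraction to `0` reduces the lifting to that of a homotopy starting at a constant map.
  let H : C(I × (M → I), B) := g.comp ⟨fun a i => a.1 * a.2 i, by fun_prop⟩
  have h0 : ∀ s, H (0, s) = p e := fun s => by
    rw [he]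
    exact congrArg g (funext fun i => zero_mul _)
  let G := hp.liftHomotopy H (.const _ e) h0
  have hG : ∀ t s, p (G (t, s)) = H (t, s) := fun t s =>
    congrFun (hp.liftHomotopy_lifts _ _ h0) (t, s)
  refine ⟨G.comp (.prodMk (.const _ 1) (.id _)), ?_, fun s => ?_⟩
  · have := hp.const_of_comp (g := fun t => G (t, 0)) (by fun_prop) (fun t t' => by
      simp only [hG]
      exact congrArg g (funext fun i => (mul_zero _).trans (mul_zero _).symm)) 1 0
    exact this.trans (hp.liftHomotopy_zero _ _ h0 _)
  · exact (hG 1 s).trans (congrArg g (funext fun i => one_mul _))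

end Boundary

/-! ### The Whitehead center inclusion -/

section Center

variable {X : Type u} {Y : Type v} {X' : Type w} {Y' : Type z}
  [TopologicalSpace X] [TopologicalSpace Y] [TopologicalSpace X'] [TopologicalSpace Y']

theorem image_homotopyDeck_subset_whiteheadCenter [SimplyConnectedSpace X']
    [SimplyConnectedSpace Y'] (hX : HasCWHomotopyType X) (hY : HasCWHomotopyType Y)
    {p : C(X', X)} {q : C(Y', Y)} (hp : IsCoveringMap p) (hq : IsCoveringMap q)
    {f : C(X, Y)} {f₀ : C(X', Y')} (hf₀ : IsLifting p q f f₀) {x₀ : X} {x₀' : X'}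
    (hx₀ : p x₀' = x₀) (hb : q (f₀ x₀') = f x₀) :
    deckLoopClass q (f₀ x₀') (f x₀) hb '' homotopyDeck p q f₀ ⊆ whiteheadCenter f x₀ := by
  rintro _ ⟨h, ⟨hcent, ⟨H⟩⟩, rfl⟩ n β
  have H0 : ∀ x, H (0, x) = f₀ x := H.apply_zero
  have H1 : ∀ x, H (1, x) = h.1 (f₀ x) := H.apply_one
  let γ : Path (f₀ x₀') (h.1 (f₀ x₀')) := ⟨⟨fun t => H (t, x₀'), by fun_prop⟩, H0 _, H1 _⟩
  rw [deckLoopClass_eq q _ _ hb h γ]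
  rcases n with _ | n
  · obtain ⟨β, rfl⟩ := HomotopyGroup.pi1EquivFundamentalGroup.symm.surjective β
    obtain ⟨b, rfl⟩ := Quotient.exists_rep β
    let bl : C(I, X') := hp.liftPath b.toContinuousMap x₀' (by simp [hx₀])
    have hbl : ∀ t, p (bl t) = b t := congrFun (hp.liftPath_lifts _ _ (by simp [hx₀]))
    have hbl0 : bl 0 = x₀' := hp.liftPath_zero _ _ (by simp [hx₀])
    obtain ⟨l, hl⟩ := exists_deck_apply_eq hX hp (e₀ := x₀') (e₁ := bl 1)
      (by rw [hbl, hx₀, b.target])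
    obtain ⟨k, hk, -⟩ := existsUnique_isInduced hY hq hf₀ l
    have hkh : ∀ z, h.1 (k.1 z) = k.1 (h.1 z) := fun z =>
      congrArg (fun d : Deck q => d.1 z) (Subgroup.mem_centralizer_iff.mp hcent k ⟨l, hk⟩).symm
    have hk0 : k.1 (f₀ x₀') = f₀ (bl 1) := by rw [← hl, hk]
    -- The endpoint of this track is `h (k (f₀ x₀'))`; centrality of `h` identifies it with the
    -- endpoint of `k ∘ γ`.
    let δ : Path (k.1 (f₀ x₀')) (k.1 (h.1 (f₀ x₀'))) :=
      ⟨⟨fun t => H (t, bl 1), by fun_prop⟩, (H0 _).trans hk0.symm, by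
        rw [← hkh, hk0]; exact H1 _⟩
    obtain ⟨J⟩ := SimplyConnectedSpace.paths_homotopic δ (γ.map k.1.continuous)
    let P : C(I × I, Y) := q.comp (H.toContinuousMap.comp ⟨fun a => (a.2, bl a.1), by fun_prop⟩)
    let Q : C(I × I, Y) := q.comp J.toContinuousMap
    -- The squares `P` and `Q` are paths in `C(I, Y)`, joined along their common side `q ∘ δ`.
    let u : Path (P.curry 0) (P.curry 1) := ⟨P.curry, rfl, rfl⟩
    have hJ0 : Q.curry 0 = P.curry 1 := ContinuousMap.ext fun t => congrArg q (J.apply_zero t)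
    let w : Path (P.curry 1) (Q.curry 1) := ⟨Q.curry, hJ0, rfl⟩
    have hu : ∀ s t, u s t = q (H (t, bl s)) := fun _ _ => rfl
    have hw : ∀ s t, w s t = q (J (s, t)) := fun _ _ => rfl
    have hqk : ∀ z, q (k.1 z) = q z := k.2
    have hqh : ∀ z, q (h.1 z) = q z := h.2
    -- The correcting square `Q` is constant at times `0` and `1`, so the joined square has `f` of
    -- `b` followed by a constant path there; `b` is reparametrized to match.
    have e : HomotopyGroup.pi1EquivFundamentalGroup.symm (Quotient.mk _ b : FundamentalGroup X x₀)
        = (Quotient.mk _ ((genLoopEquivOfUnique (Fin 1)).symm (b.trans (Path.refl x₀))) :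
          HomotopyGroup (Fin 1) X x₀) := by
      have : (Quotient.mk _ b : Path.Homotopic.Quotient x₀ x₀) =
          Quotient.mk _ (b.trans (Path.refl x₀)) :=
        Quotient.sound ⟨(Path.Homotopy.transRefl b).symm⟩
      exact congrArg HomotopyGroup.pi1EquivFundamentalGroup.symm this
    rw [e]
    have ht : ∀ t (_ : t = 0 ∨ t = 1) s, (u.trans w) s t = f ((b.trans (Path.refl x₀)) s) := by
      intro t ht s
      simp only [Path.trans_apply]
      split_ifs with hs
      · rw [hu]
        rcases ht with rfl | rfl
        · rw [H0, hf₀, hbl]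
        · rw [H1, hqh, hf₀, hbl]
      · rw [hw]
        rcases ht with rfl | rfl
        · rw [show J (_, (0 : I)) = k.1 (f₀ x₀') from J.source _, hqk, hb]
          rfl
        · rw [show J (_, (1 : I)) = k.1 (h.1 (f₀ x₀')) from J.target _, hqk, hqh, hb]
          rfl
    refine whiteheadProduct_eq_trivial _ _
      ((u.trans w).toContinuousMap.uncurry.comp ⟨fun a => (a.1 0, a.2), by fun_prop⟩)
      (fun s => ht 0 (Or.inl rfl) _) (fun s => ht 1 (Or.inr rfl) _) ?_
    rintro s ⟨i, hi⟩ t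
    obtain rfl : i = 0 := Subsingleton.elim (α := Fin 1) _ _
    change (u.trans w) (s 0) t = q (H (t, x₀'))
    rcases hi with hi | hi
    · rw [hi, (u.trans w).source, ← hbl0]
      rfl
    · rw [hi, (u.trans w).target]
      change q (J (1, t)) = _
      rw [J.apply_one]
      exact hqk _
  · obtain ⟨b, rfl⟩ := Quotient.exists_rep β
    obtain ⟨bl, hbl0, hbl⟩ := exists_lift_cube hp b.1 x₀'
      (hx₀.trans (b.2 0 ⟨0, Or.inl rfl⟩).symm)
    have hbd : ∀ s ∈ Cube.boundary (Fin (n + 1 + 1)), bl s = x₀' := fun s hs =>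
      (eq_apply_zero_of_mem_boundary hp bl (fun s hs => (hbl s).trans (b.2 s hs)) s hs).trans hbl0
    refine whiteheadProduct_eq_trivial _ _
      (q.comp (H.toContinuousMap.comp ⟨fun a => (a.2, bl a.1), by fun_prop⟩)) ?_ ?_ ?_
    · intro s
      change q (H (0, bl s)) = f (b.1 s)
      rw [H0, hf₀, hbl]
    · intro s
      change q (H (1, bl s)) = f (b.1 s)
      rw [H1, h.2, hf₀, hbl]
    · intro s hs t
      change q (H (t, bl s)) = q (H (t, x₀'))
      rw [hbd s hs]

end Center

end GottliebDeck

end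

open GottliebDeck in
theorem proposition2p3 {X Y X' Y' : Type*}
    [TopologicalSpace X] [TopologicalSpace Y] [TopologicalSpace X'] [TopologicalSpace Y']
    [PathConnectedSpace X] [PathConnectedSpace Y]
    (hX : HasCWHomotopyType X) (hY : HasCWHomotopyType Y)
    [SimplyConnectedSpace X'] [SimplyConnectedSpace Y']
    (p : C(X', X)) (q : C(Y', Y)) (hp : IsCoveringMap p) (hq : IsCoveringMap q)
    (f : C(X, Y)) (f₀ : C(X', Y')) (hf₀ : IsLifting p q f f₀)
    (x₀ : X) (x₀' : X') (hx₀ : p x₀' = x₀) :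
    have hb : q (f₀ x₀') = f x₀ := (hf₀ x₀').trans (congrArg f hx₀)
    (∀ l : Deck p, ∃! k : Deck q, IsInduced f₀ l k) ∧
    Function.Bijective (deckLoopClass q (f₀ x₀') (f x₀) hb) ∧
    gottlieb f x₀ ⊆ deckLoopClass q (f₀ x₀') (f x₀) hb '' homotopyDeck p q f₀ ∧
    deckLoopClass q (f₀ x₀') (f x₀) hb '' homotopyDeck p q f₀ ⊆ whiteheadCenter f x₀ := by
  intro hb
  exact ⟨existsUnique_isInduced hY hq hf₀,
    ⟨deckLoopClass_injective hq hb, deckLoopClass_surjective hY hq hb⟩,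
    gottlieb_subset_image_homotopyDeck hY hq hf₀ hx₀ hb,
    image_homotopyDeck_subset_whiteheadCenter hX hY hp hq hf₀ hx₀ hb⟩
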